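/- Let $q$ be a real number with $-1<q<1$, let $m\ge 0$, and let $\boldsymbol n=(n_1,\dots,n_m)$ be an $m$-tuple of nonnegative integers with $n=n_1+\cdots+n_m$. Split $\{1,\dots,n\}$ into the consecutive boxes $S_j=\{n_1+\cdots+n_{j-1}+1,\dots,n_1+\cdots+n_j\}$, $1\le j\le m$. Let $\mathcal K(\boldsymbol n)$ be the set of inhomogeneous perfect matchings, that is, of the partitions of $\{1,\dots,n\}$ into two-element blocks none of which is contained in a box. Write a block $\{i,j\}$ with $i<j$ as an arc $(i,j)$, let $\mathrm{cr}(M)$ be the number of pairs of arcs $(i,j),(k,\ell)$ of $M$ with $i<k<j<\ell$, and set $$K(\boldsymbol n|q)=\sum_{M\in\mathcal K(\boldsymbol n)}q^{\mathrm{cr}(M)}\qquad(0^0=1).$$ Let $H_n(x|q)$ be the continuous $q$-Hermite polynomials, defined by $H_0(x|q)=1$, $H_1(x|q)=2x$ and $2xH_n(x|q)=H_{n+1}(x|q)+(1-q^n)H_{n-1}(x|q)$ for $n>0$, and let $\tilde H_n(x|q)=a^{-n}H_n\!\left(\tfrac12 ax\,\middle|\,q\right)$ with $a=\sqrt{1-q}$.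 Let $$\tilde v(x|q)=\frac{\sqrt{1-q}\;\prod_{k\ge1}(1-q^k)}{4\pi\sqrt{1-(1-q)x^2/4}}\prod_{k=0}^\infty\left\{1+(2-x^2(1-q))q^k+q^{2k}\right\}\quad\text{for } |x|<\frac{2}{\sqrt{1-q}},$$ and $\tilde v(x|q)=0$ for all other real $x$. Then $x\mapsto\tilde v(x|q)\prod_{j=1}^m\tilde H_{n_j}(x|q)$ is integrable on $\mathbb R$ and $$K(\boldsymbol n|q)=\int_{\mathbb R}\tilde v(x|q)\prod_{j=1}^m\tilde H_{n_j}(x|q)\,dx .$$ -/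

import Mathlib

namespace QHermite

/-! ### Inhomogeneous perfect matchings

For `n = (n_1, …, n_m)`, the balls are the elements of `Fin (∑ j, n j)`
(numbered from `0` instead of from `1`), split into consecutive boxes of sizes `n_1, …, n_m`. -/

/-- The box `S_j`: the balls `i` with `n_1 + ⋯ + n_{j-1} ≤ i < n_1 + ⋯ + n_j`. -/
def box {m : ℕ} (n : Fin m → ℕ) (j : Fin m) : Finset (Fin (∑ j, n j)) :=
  Finset.univ.filter fun i =>
    ∑ k ∈ Finset.Iio j, n k ≤ (i : ℕ) ∧ (i : ℕ) < ∑ k ∈ Finset.Iic j, n k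

/-- A perfect matching of `{0, …, N - 1}` is a set partition all of whose blocks have
exactly two elements. -/
def IsPerfectMatching {N : ℕ} (M : Finpartition (Finset.univ : Finset (Fin N))) : Prop :=
  ∀ B ∈ M.parts, B.card = 2

/-- No two distinct elements of a block lie in the same box. (The further requirement on an
inhomogeneous partition, that each block has at least two elements, is part of
`IsPerfectMatching`.) -/
def IsInhomogeneous {m : ℕ} (n : Fin m → ℕ)
    (M : Finpartition (Finset.univ : Finset (Fin (∑ j, n j)))) : Prop :=
  ∀ B ∈ M.parts, ∀ x ∈ B, ∀ y ∈ B, x ≠ y → ∀ j, ¬ (x ∈ box n j ∧ y ∈ box n j)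

/-- The arcs `(i, j)`, `i < j`, of a perfect matching. -/
def arcs {N : ℕ} (M : Finpartition (Finset.univ : Finset (Fin N))) : Finset (Fin N × Fin N) :=
  Finset.univ.filter fun e => e.1 < e.2 ∧ {e.1, e.2} ∈ M.parts

/-- The number of crossings of a perfect matching: pairs of arcs `((i, j), (k, l))` with
`i < k < j < l`. -/
def cr {N : ℕ} (M : Finpartition (Finset.univ : Finset (Fin N))) : ℕ :=
  ((arcs M ×ˢ arcs M).filter fun p =>
    p.1.1 < p.2.1 ∧ p.2.1 < p.1.2 ∧ p.1.2 < p.2.2).card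

open Classical in
/-- The set of inhomogeneous perfect matchings of the boxed set `[n]`. -/
noncomputable def inhomMatchings {m : ℕ} (n : Fin m → ℕ) :
    Finset (Finpartition (Finset.univ : Finset (Fin (∑ j, n j)))) :=
  Finset.univ.filter fun M => IsPerfectMatching M ∧ IsInhomogeneous n M

/-- `K(n|q)`, the generating polynomial of inhomogeneous perfect matchings by crossings. -/
noncomputable def K {m : ℕ} (n : Fin m → ℕ) (q : ℝ) : ℝ :=
  ∑ M ∈ inhomMatchings n, q ^ cr M

/-! ### Continuous `q`-Hermite polynomials -/

/-- The continuous `q`-Hermite polynomials: `H_0 = 1`, `H_1 = 2x`,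
`2x H_n = H_{n+1} + (1 - q^n) H_{n-1}` for `n > 0`. -/
noncomputable def contHermite (q : ℝ) : ℕ → Polynomial ℝ
  | 0 => 1
  | 1 => 2 * Polynomial.X
  | n + 2 => 2 * Polynomial.X * contHermite q (n + 1)
      - Polynomial.C (1 - q ^ (n + 1)) * contHermite q n

/-- The rescaled polynomials `H̃_n(x|q) = H_n(a x / 2 | q) / a^n`, `a = √(1 - q)`. -/
noncomputable def rescaledHermite (q : ℝ) (n : ℕ) (x : ℝ) : ℝ :=
  (contHermite q n).eval (1 / 2 * √(1 - q) * x) / √(1 - q) ^ n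

/-- The infinite `q`-shifted factorial `(q; q)_∞ = ∏_{k ≥ 1} (1 - q^k)`. -/
noncomputable def qPochInfty (q : ℝ) : ℝ := ∏' k : ℕ, (1 - q ^ (k + 1))

open Classical in
/-- The weight `ṽ(x|q)`, supported on `|x| ≤ 2 / √(1 - q)`
(its values at the two end points are irrelevant). -/
noncomputable def weight (q : ℝ) (x : ℝ) : ℝ :=
  if |x| < 2 / √(1 - q) then
    √(1 - q) * qPochInfty q / (√(1 - (1 - q) * x ^ 2 / 4) * (4 * Real.pi)) *
      ∏' k : ℕ, (1 + (2 - x ^ 2 * (1 - q)) * q ^ k + q ^ (2 * k))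
  else 0

end QHermite

/-!
Regard the open points of a partial matching as arcs ending at infinity. Then `∏ H̃_{n_j}` is the
sum of `q ^ crossings * H̃_{#open points}` over the partial matchings without arcs inside a box.
Indeed, appending a point to the last box acts on the functions of the numbers of open points to the
left of the box and in the box as a `q`-oscillator, and normal ordering of its powers reproduces the
three-term recurrence of `H̃`.

It remains to see that `H̃_n` has integral `1` for `n = 0` and `0` otherwise, so that only the
perfect matchings survive. For odd `n` this is parity. For even `n`, Rogers' expansion writes `H_n`
with Gaussian binomial coefficients in the Chebyshev polynomials, and the Jacobi triple product
gives the Chebyshev coefficients of the weight. In the resulting sum one recognises the finite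
triple product `(z; q)_M (q / z; q)_N` at its zero `z = 1`.
-/

namespace QHermite

open Finset Polynomial
open Polynomial.Chebyshev (T T_add_one T_neg T_two T_mul_T measureT integral_measureT
  integrable_measureT integral_measureT_eq_integral_cos integral_eval_T_real_measureT_zero
  integral_eval_T_real_measureT_of_ne_zero integral_eval_T_real_mul_eval_T_real_measureT
  intervalIntegrable_sqrt_one_sub_sq_inv)

section QInt

/-- The `q`-integer `[n] = 1 + q + ⋯ + q ^ (n - 1)`. -/
def qInt {R : Type*} [Semiring R] (q : R) (n : ℕ) : R := ∑ j ∈ range n, q ^ j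

section Semiring

variable {R : Type*} [Semiring R] (q : R)

@[simp] lemma qInt_zero : qInt q 0 = 0 := sum_range_zero _

lemma qInt_succ (n : ℕ) : qInt q (n + 1) = qInt q n + q ^ n := sum_range_succ _ _

lemma qInt_succ' (n : ℕ) : qInt q (n + 1) = 1 + q * qInt q n := by
  simp only [qInt, sum_range_succ', mul_sum, pow_zero, pow_succ']
  exact add_comm _ _

lemma qInt_add (m n : ℕ) : qInt q (m + n) = qInt q m + q ^ m * qInt q n := by
  simp only [qInt, sum_range_add, mul_sum, pow_add]

end Semiring

lemma one_sub_mul_qInt {R : Type*} [Ring R] (q : R) (n : ℕ) : (1 - q) * qInt q n = 1 - q ^ n :=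
  mul_neg_geom_sum q n

lemma sum_pow_card_filter_lt {R : Type*} [Semiring R] (q : R) (S : Finset ℕ) :
    ∑ i ∈ S, q ^ #{k ∈ S | i < k} = qInt q #S := by
  induction S using Finset.induction_on_min with
  | empty => simp
  | insert a S ha ih =>
    have haS : a ∉ S := fun h => lt_irrefl _ (ha a h)
    have hS : ∀ i ∈ S, {k ∈ insert a S | i < k} = {k ∈ S | i < k} := fun i hi => by
      rw [filter_insert, if_neg (ha i hi).not_gt]
    rw [sum_insert haS, card_insert_of_notMem haS, qInt_succ, ← ih, add_comm,
      sum_congr rfl fun i hi => by rw [hS i hi], filter_insert, if_neg (lt_irrefl a),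
      filter_true_of_mem ha]

lemma card_filter_lt_eq_add {S : Finset ℕ} {t i : ℕ} (hi : i < t) :
    #{k ∈ S | i < k} = #{k ∈ S | t ≤ k} + #{k ∈ {k ∈ S | k < t} | i < k} := by
  rw [← card_union_of_disjoint (disjoint_left.2 fun k => by grind)]
  congr 1
  grind

lemma sum_filter_pow_card_filter_lt {R : Type*} [Semiring R] (q : R) (S : Finset ℕ) (t : ℕ) :
    ∑ i ∈ S with i < t, q ^ #{k ∈ S | i < k} =
      q ^ #{k ∈ S | t ≤ k} * qInt q #{i ∈ S | i < t} := by
  rw [← sum_pow_card_filter_lt, mul_sum]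
  refine sum_congr rfl fun i hi => ?_
  rw [← pow_add, card_filter_lt_eq_add (mem_filter.1 hi).2]

lemma pow_succ_mul_eq_of_mul_eq {R A : Type*} [CommSemiring R] [Semiring A] [Algebra R A] {q : R}
    {t d : A} (h : t * d = 1 + q • (d * t)) (k : ℕ) :
    t ^ (k + 1) * d = qInt q (k + 1) • t ^ k + q ^ (k + 1) • (d * t ^ (k + 1)) := by
  induction k with
  | zero => simp [qInt, h]
  | succ k ih =>
    calc t ^ (k + 2) * d = t * (t ^ (k + 1) * d) := by rw [pow_succ' _ (k + 1), mul_assoc]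
      _ = qInt q (k + 1) • t ^ (k + 1) + q ^ (k + 1) • (t * d * t ^ (k + 1)) := by
        rw [ih, mul_add, mul_smul_comm, mul_smul_comm, ← pow_succ', mul_assoc]
      _ = qInt q (k + 2) • t ^ (k + 1) + q ^ (k + 2) • (d * t ^ (k + 2)) := by
        rw [h, qInt_succ q (k + 1), add_mul, one_mul, smul_add, smul_mul_assoc, smul_smul,
          ← pow_succ, mul_assoc, ← pow_succ', add_smul, ← add_assoc]

end QInt

section Oscillator

variable {R : Type*} [CommRing R] (q : R)

/-- The transfer operator of a box. If `g h o` is the weight of a partial matching with `h` open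
points to the left of the box and `o` open points in it, `addPoint q g h o` is the total weight of
the matchings obtained by adding one point at the right end of the box, which is either left open
or joined to one of the `h` open points on the left. -/
def addPoint : Module.End R (ℕ → ℕ → R) where
  toFun g h o := g h (o + 1) + q ^ o * qInt q h * g (h - 1) o
  map_add' f g := by funext h o; simp only [Pi.add_apply]; ring
  map_smul' c g := by
    funext h o; simp only [Pi.smul_apply, smul_eq_mul, RingHom.id_apply]; ring

/-- The `q`-annihilation operator in the number `o` of open points of a box. -/
def removePoint : Module.End R (ℕ → ℕ → R) where
  toFun g h o := qInt q o * g h (o - 1)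
  map_add' f g := by funext h o; simp only [Pi.add_apply]; ring
  map_smul' c g := by
    funext h o; simp only [Pi.smul_apply, smul_eq_mul, RingHom.id_apply]; ring

lemma addPoint_apply (g : ℕ → ℕ → R) (h o : ℕ) :
    addPoint q g h o = g h (o + 1) + q ^ o * qInt q h * g (h - 1) o := rfl

lemma removePoint_apply (g : ℕ → ℕ → R) (h o : ℕ) :
    removePoint q g h o = qInt q o * g h (o - 1) := rfl

@[simp] lemma removePoint_apply_zero (g : ℕ → ℕ → R) (h : ℕ) : removePoint q g h 0 = 0 := by
  simp [removePoint_apply]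

lemma addPoint_mul_removePoint :
    addPoint q * removePoint q = 1 + q • (removePoint q * addPoint q) := by
  ext g h o
  simp only [Module.End.mul_apply, LinearMap.add_apply, Module.End.one_apply, LinearMap.smul_apply,
    Pi.add_apply, Pi.smul_apply, smul_eq_mul, addPoint_apply, removePoint_apply, qInt_succ',
    Nat.add_sub_cancel]
  cases o with
  | zero => simp
  | succ o => rw [Nat.add_sub_cancel, qInt_succ']; ring

variable {q} {x : R} {η : ℕ → R}

lemma addPoint_apply_add (hη : ∀ n, η (n + 1) = x * η n - qInt q n * η (n - 1)) :
    addPoint q (fun h o => η (h + o)) =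
      x • (fun h o => η (h + o)) - removePoint q (fun h o => η (h + o)) := by
  funext h o
  simp only [addPoint_apply, removePoint_apply, Pi.sub_apply, Pi.smul_apply, smul_eq_mul,
    ← add_assoc, hη (h + o)]
  rw [add_comm h o, qInt_add, add_comm o h]
  rcases h with _ | h <;> rcases o with _ | o
  · simp
  · simp
  · simp
  · simp only [← add_assoc, add_right_comm, Nat.add_sub_cancel]
    ring

/-- Both sides satisfy the three-term recurrence of `η` in `k`, by normal ordering. -/
lemma addPoint_pow_apply_add_zero (h0 : η 0 = 1)
    (hη : ∀ n, η (n + 1) = x * η n - qInt q n * η (n - 1)) (k h : ℕ) :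
    (addPoint q ^ k) (fun h o => η (h + o)) h 0 = η k * η h := by
  induction k using Nat.twoStepInduction with
  | zero => simp [h0]
  | one => simp [addPoint_apply_add hη, hη 0, h0]
  | more k ih₁ ih₂ =>
    set f : ℕ → ℕ → R := fun h o => η (h + o)
    have normal_order : (addPoint q ^ (k + 1)) (removePoint q f) h 0 =
        qInt q (k + 1) * (addPoint q ^ k) f h 0 := by
      have := congr_fun₂ (LinearMap.congr_fun
        (pow_succ_mul_eq_of_mul_eq (addPoint_mul_removePoint q) k) f) h 0
      simpa [Module.End.mul_apply] using this
    calc (addPoint q ^ (k + 2)) f h 0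
        = (addPoint q ^ (k + 1)) (x • f - removePoint q f) h 0 := by
          rw [pow_succ, Module.End.mul_apply, addPoint_apply_add hη]
      _ = x * (η (k + 1) * η h) - qInt q (k + 1) * (η k * η h) := by
          rw [map_sub, map_smul, Pi.sub_apply, Pi.sub_apply, normal_order, ih₁, ← ih₂]
          rfl
      _ = η (k + 2) * η h := by rw [hη (k + 1), Nat.add_sub_cancel]; ring

end Oscillator

section PartialMatchings

/-- A set of arcs on the points `0, …, N - 1`, no two of which share an end point, and whose end
points are related by `r`. -/
structure IsPartialMatching (r : ℕ → ℕ → Prop) (N : ℕ) (A : Finset (ℕ × ℕ)) : Prop where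
  fst_lt_snd : ∀ e ∈ A, e.1 < e.2
  snd_lt : ∀ e ∈ A, e.2 < N
  rel : ∀ e ∈ A, r e.1 e.2
  eq_of_endpoint : ∀ e ∈ A, ∀ f ∈ A, ∀ a, (a = e.1 ∨ a = e.2) → (a = f.1 ∨ a = f.2) → e = f

open Classical in
/-- The partial matchings of `{0, …, N - 1}` with arcs in `r`. -/
noncomputable def partialMatchings (r : ℕ → ℕ → Prop) (N : ℕ) : Finset (Finset (ℕ × ℕ)) :=
  (range N ×ˢ range N).powerset.filter (IsPartialMatching r N)

/-- The points of `{0, …, N - 1}` not covered by an arc. -/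
def openPts (N : ℕ) (A : Finset (ℕ × ℕ)) : Finset ℕ :=
  {i ∈ range N | ∀ e ∈ A, ¬ (i = e.1 ∨ i = e.2)}

/-- The number of crossings of a partial matching, where each open point is regarded as the left
end of an arc that ends to the right of all points, these arcs not crossing each other. -/
def openCr (N : ℕ) (A : Finset (ℕ × ℕ)) : ℕ :=
  ∑ e ∈ A, (#{f ∈ A | e.1 < f.1 ∧ f.1 < e.2 ∧ e.2 < f.2} +
    #{k ∈ openPts N A | e.1 < k ∧ k < e.2})

variable {r : ℕ → ℕ → Prop} {N i : ℕ} {A : Finset (ℕ × ℕ)}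

lemma mem_partialMatchings : A ∈ partialMatchings r N ↔ IsPartialMatching r N A := by
  simp only [partialMatchings, mem_filter, mem_powerset, and_iff_right_iff_imp]
  intro hA e he
  have := hA.fst_lt_snd e he
  have := hA.snd_lt e he
  simp only [mem_product, mem_range]
  omega

lemma mem_openPts : i ∈ openPts N A ↔ i < N ∧ ∀ e ∈ A, ¬ (i = e.1 ∨ i = e.2) := by
  simp [openPts]

lemma partialMatchings_zero (r : ℕ → ℕ → Prop) : partialMatchings r 0 = {∅} := by
  ext A
  rw [mem_partialMatchings, mem_singleton]
  refine ⟨fun hA => eq_empty_of_forall_notMem fun e he => (Nat.not_lt_zero _ (hA.snd_lt e he)), ?_⟩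
  rintro rfl
  constructor <;> simp

lemma notMem_of_mem_openPts {j : ℕ} (hi : i ∈ openPts N A) : (i, j) ∉ A :=
  fun h => (mem_openPts.1 hi).2 _ h (Or.inl rfl)

namespace IsPartialMatching

lemma notMem_last (hA : IsPartialMatching r N A) : (i, N) ∉ A :=
  fun h => lt_irrefl _ (hA.snd_lt _ h)

lemma succ_of_open (hA : IsPartialMatching r N A) : IsPartialMatching r (N + 1) A :=
  ⟨hA.fst_lt_snd, fun e he => (hA.snd_lt e he).trans N.lt_succ_self, hA.rel, hA.eq_of_endpoint⟩

lemma of_succ_of_open (hA : IsPartialMatching r (N + 1) A) (hN : ∀ i, (i, N) ∉ A) :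
    IsPartialMatching r N A :=
  ⟨hA.fst_lt_snd, fun e he => (Nat.lt_succ_iff.1 (hA.snd_lt e he)).lt_of_ne
    fun h => hN e.1 (h ▸ he), hA.rel, hA.eq_of_endpoint⟩

lemma insert_last (hA : IsPartialMatching r N A) (hi : i ∈ openPts N A) (hr : r i N) :
    IsPartialMatching r (N + 1) (insert (i, N) A) := by
  obtain ⟨hiN, hi⟩ := mem_openPts.1 hi
  have not_endpoint : ∀ f ∈ A, ∀ a, (a = i ∨ a = N) → ¬ (a = f.1 ∨ a = f.2) := by
    rintro f hf a (rfl | rfl)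
    · exact hi f hf
    · have := hA.fst_lt_snd f hf
      have := hA.snd_lt f hf
      omega
  refine ⟨forall_mem_insert _ _ _ |>.2 ⟨hiN, hA.fst_lt_snd⟩,
    forall_mem_insert _ _ _ |>.2 ⟨N.lt_succ_self, hA.succ_of_open.snd_lt⟩,
    forall_mem_insert _ _ _ |>.2 ⟨hr, hA.rel⟩, fun e he f hf a hae haf => ?_⟩
  rcases mem_insert.1 he with rfl | he <;> rcases mem_insert.1 hf with rfl | hf
  · rfl
  · exact absurd haf (not_endpoint f hf a hae)
  · exact absurd hae (not_endpoint e he a haf)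
  · exact hA.eq_of_endpoint e he f hf a hae haf

lemma mono {B : Finset (ℕ × ℕ)} (hA : IsPartialMatching r N A) (hBA : B ⊆ A) :
    IsPartialMatching r N B :=
  ⟨fun e he => hA.fst_lt_snd e (hBA he), fun e he => hA.snd_lt e (hBA he),
    fun e he => hA.rel e (hBA he),
    fun e he f hf => hA.eq_of_endpoint e (hBA he) f (hBA hf)⟩

lemma erase_last (hA : IsPartialMatching r (N + 1) A) (hi : (i, N) ∈ A) :
    IsPartialMatching r N (A.erase (i, N)) :=
  (hA.mono (erase_subset _ _)).of_succ_of_open fun _ hj =>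
    ne_of_mem_erase hj
      (hA.eq_of_endpoint _ (mem_of_mem_erase hj) _ hi N (Or.inr rfl) (Or.inr rfl))

lemma mem_openPts_erase_last (hA : IsPartialMatching r (N + 1) A) (hi : (i, N) ∈ A) :
    i ∈ openPts N (A.erase (i, N)) := by
  refine mem_openPts.2 ⟨hA.fst_lt_snd _ hi, fun e he hie => ?_⟩
  exact ne_of_mem_erase he (hA.eq_of_endpoint e (mem_of_mem_erase he) _ hi i hie (Or.inl rfl))

lemma openPts_succ (hA : IsPartialMatching r N A) :
    openPts (N + 1) A = insert N (openPts N A) := by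
  ext i
  have := hA.fst_lt_snd
  have := hA.snd_lt
  grind [mem_openPts]

lemma openCr_succ (hA : IsPartialMatching r N A) : openCr (N + 1) A = openCr N A := by
  refine sum_congr rfl fun e he => ?_
  rw [hA.openPts_succ, filter_insert, if_neg fun h => lt_asymm h.2 (hA.snd_lt e he)]

end IsPartialMatching

open Classical in
lemma sum_partialMatchings_succ {R : Type*} [AddCommMonoid R] (r : ℕ → ℕ → Prop) (N : ℕ)
    (F : Finset (ℕ × ℕ) → R) :
    ∑ A ∈ partialMatchings r (N + 1), F A =
      ∑ A ∈ partialMatchings r N, (F A + ∑ i ∈ openPts N A with r i N, F (insert (i, N) A)) := by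
  rw [sum_add_distrib, ← sum_filter_add_sum_filter_not _ (fun A => ∀ i, (i, N) ∉ A), sum_sigma']
  congr 1
  · refine sum_congr (ext fun A => ?_) fun _ _ => rfl
    rw [mem_filter, mem_partialMatchings, mem_partialMatchings]
    exact ⟨fun h => h.1.of_succ_of_open h.2, fun h => ⟨h.succ_of_open, fun _ => h.notMem_last⟩⟩
  · symm
    refine sum_bij (fun p _ => insert (p.2, N) p.1) ?_ ?_ ?_ fun _ _ => rfl
    · rintro ⟨A, i⟩ hA
      simp only [mem_sigma, mem_filter, mem_partialMatchings] at hA ⊢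
      exact ⟨hA.1.insert_last hA.2.1 hA.2.2, fun hN => hN i (mem_insert_self _ _)⟩
    · rintro ⟨A, i⟩ hA ⟨B, j⟩ hB heq
      simp only [mem_sigma, mem_partialMatchings] at hA hB heq
      obtain rfl : i = j := by
        have : (i, N) ∈ insert (j, N) B := heq ▸ mem_insert_self _ _
        simpa [hB.1.notMem_last] using this
      rw [← erase_insert (hA.1.notMem_last (i := i)), heq, erase_insert hB.1.notMem_last]
    · intro A hA
      simp only [mem_filter, mem_partialMatchings, not_forall, not_not] at hA
      obtain ⟨hA, i, hi⟩ := hA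
      refine ⟨⟨A.erase (i, N), i⟩, ?_, insert_erase hi⟩
      simp only [mem_sigma, mem_filter, mem_partialMatchings]
      exact ⟨hA.erase_last hi, hA.mem_openPts_erase_last hi, hA.rel _ hi⟩

lemma openPts_insert_last (N i : ℕ) (A : Finset (ℕ × ℕ)) :
    openPts (N + 1) (insert (i, N) A) = (openPts N A).erase i := by
  ext j
  simp only [mem_openPts, mem_erase, forall_mem_insert]
  grind

/-- The new arc `(i, N)` crosses the arcs that the open point `i` crossed before, and the arcs of
the open points to the right of `i`. -/
lemma IsPartialMatching.openCr_insert_last (hA : IsPartialMatching r N A) (hi : i ∈ openPts N A) :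
    openCr (N + 1) (insert (i, N) A) = openCr N A + #{k ∈ openPts N A | i < k} := by
  have new_arc : #{f ∈ insert (i, N) A | i < f.1 ∧ f.1 < N ∧ N < f.2} +
      #{k ∈ (openPts N A).erase i | i < k ∧ k < N} = #{k ∈ openPts N A | i < k} := by
    rw [filter_eq_empty_iff.2 fun e he => ?_, card_empty, zero_add]
    · congr 1
      grind [mem_openPts]
    · have := hA.snd_lt
      grind
  have old_arc : ∀ e ∈ A, #{f ∈ insert (i, N) A | e.1 < f.1 ∧ f.1 < e.2 ∧ e.2 < f.2} +
      #{k ∈ (openPts N A).erase i | e.1 < k ∧ k < e.2} =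
        #{f ∈ A | e.1 < f.1 ∧ f.1 < e.2 ∧ e.2 < f.2} +
          #{k ∈ openPts N A | e.1 < k ∧ k < e.2} := by
    intro e he
    rw [filter_insert, filter_erase]
    by_cases hc : e.1 < i ∧ i < e.2
    · rw [if_pos ⟨hc.1, hc.2, hA.snd_lt e he⟩, card_insert_of_notMem
        (fun h => notMem_of_mem_openPts hi (mem_filter.1 h).1), add_assoc, add_comm 1,
        card_erase_add_one (mem_filter.2 ⟨hi, hc⟩)]
    · rw [if_neg fun h => hc ⟨h.1, h.2.1⟩, erase_eq_of_notMem (by simp [hc])]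
  rw [openCr, sum_insert (notMem_of_mem_openPts hi), openPts_insert_last, new_arc,
    sum_congr rfl old_arc, add_comm, openCr]

end PartialMatchings

section MatchingSum

variable {R : Type*} [CommRing R] {q : R} {r : ℕ → ℕ → Prop}

/-- The sum over all partial matchings of `q ^ openCr` times a function of the numbers of open
points to the left and to the right of `t`. -/
noncomputable def matchingSum (q : R) (r : ℕ → ℕ → Prop) (N t : ℕ) (g : ℕ → ℕ → R) : R :=
  ∑ A ∈ partialMatchings r N,
    q ^ openCr N A * g #{i ∈ openPts N A | i < t} #{i ∈ openPts N A | t ≤ i}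

lemma matchingSum_succ {N t : ℕ} (ht : t ≤ N) (hr : ∀ i, r i N ↔ i < t) (g : ℕ → ℕ → R) :
    matchingSum q r (N + 1) t g = matchingSum q r N t (addPoint q g) := by
  rw [matchingSum, sum_partialMatchings_succ]
  refine sum_congr rfl fun A hA => ?_
  rw [mem_partialMatchings] at hA
  rw [addPoint_apply, mul_add]
  congr 1
  · have hN : N ∉ {i ∈ openPts N A | t ≤ i} := fun h =>
      lt_irrefl _ (mem_openPts.1 (mem_filter.1 h).1).1
    rw [hA.openCr_succ, hA.openPts_succ, filter_insert, filter_insert, if_neg ht.not_gt,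
      if_pos ht, card_insert_of_notMem hN]
  · simp only [hr]
    rw [← sum_filter_pow_card_filter_lt, sum_mul, mul_sum]
    refine sum_congr rfl fun i hi => ?_
    obtain ⟨hi_open, hit⟩ := mem_filter.1 hi
    have hi_right : i ∉ {i ∈ openPts N A | t ≤ i} := fun h => hit.not_ge (mem_filter.1 h).2
    rw [hA.openCr_insert_last hi_open, openPts_insert_last, filter_erase, filter_erase,
      card_erase_of_mem hi, erase_eq_of_notMem hi_right, pow_add, mul_assoc]

lemma matchingSum_add {t k : ℕ} (hr : ∀ l, t ≤ l → l < t + k → ∀ i, r i l ↔ i < t)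
    (g : ℕ → ℕ → R) :
    matchingSum q r (t + k) t g = matchingSum q r t t ((addPoint q ^ k) g) := by
  induction k generalizing g with
  | zero => rfl
  | succ k ih =>
    rw [← add_assoc, matchingSum_succ (t.le_add_right k) (hr _ (by omega) (by omega)),
      ih fun l h₁ h₂ => hr l h₁ (by omega), pow_succ, Module.End.mul_apply]

lemma matchingSum_apply_add (N t : ℕ) (η : ℕ → R) :
    matchingSum q r N t (fun h o => η (h + o)) =
      ∑ A ∈ partialMatchings r N, q ^ openCr N A * η #(openPts N A) := by
  refine sum_congr rfl fun A _ => ?_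
  simp only [← not_lt, card_filter_add_card_filter_not]

lemma matchingSum_self (t : ℕ) (g : ℕ → ℕ → R) :
    matchingSum q r t t g = ∑ A ∈ partialMatchings r t, q ^ openCr t A * g #(openPts t A) 0 := by
  refine sum_congr rfl fun A _ => ?_
  have hlt : ∀ i ∈ openPts t A, i < t := fun i hi => (mem_openPts.1 hi).1
  rw [filter_true_of_mem hlt, filter_false_of_mem fun i hi => (hlt i hi).not_ge, card_empty]

lemma sum_partialMatchings_add {x : R} {η : ℕ → R} (h0 : η 0 = 1)
    (hη : ∀ n, η (n + 1) = x * η n - qInt q n * η (n - 1)) {t k : ℕ}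
    (hr : ∀ l, t ≤ l → l < t + k → ∀ i, r i l ↔ i < t) :
    ∑ A ∈ partialMatchings r (t + k), q ^ openCr (t + k) A * η #(openPts (t + k) A) =
      η k * ∑ A ∈ partialMatchings r t, q ^ openCr t A * η #(openPts t A) := by
  rw [← matchingSum_apply_add _ t, matchingSum_add hr, matchingSum_self, mul_sum]
  exact sum_congr rfl fun A _ => by rw [addPoint_pow_apply_add_zero h0 hη]; ring

/-- Two points are separated if a box starts between them, the box with index `j` being
`{T j, …, T (j + 1) - 1}`. -/
def Separated (T : ℕ → ℕ) (i l : ℕ) : Prop := ∃ j, i < T j ∧ T j ≤ l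

lemma separated_iff_lt {T : ℕ → ℕ} (hT : Monotone T) {j l : ℕ} (h₁ : T j ≤ l)
    (h₂ : l < T (j + 1)) (i : ℕ) : Separated T i l ↔ i < T j := by
  refine ⟨fun ⟨k, hik, hkl⟩ => hik.trans_le (hT ?_), fun h => ⟨j, h, h₁⟩⟩
  exact Nat.lt_succ_iff.1 (hT.reflect_lt (hkl.trans_lt h₂))

lemma prod_eq_sum_partialMatchings {x : R} {η : ℕ → R} (h0 : η 0 = 1)
    (hη : ∀ n, η (n + 1) = x * η n - qInt q n * η (n - 1)) {T : ℕ → ℕ} (hT : Monotone T)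
    (hT0 : T 0 = 0) (m : ℕ) :
    ∏ j ∈ range m, η (T (j + 1) - T j) =
      ∑ A ∈ partialMatchings (Separated T) (T m), q ^ openCr (T m) A * η #(openPts (T m) A) := by
  induction m with
  | zero => simp [hT0, partialMatchings_zero, openCr, openPts, h0]
  | succ m ih =>
    obtain ⟨k, hk⟩ := Nat.exists_eq_add_of_le (hT m.le_succ)
    rw [prod_range_succ, ih, hk, Nat.add_sub_cancel_left, sum_partialMatchings_add h0 hη, mul_comm]
    exact fun l h₁ h₂ => separated_iff_lt hT h₁ (hk ▸ h₂)

end MatchingSum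

section Boxes

variable {m : ℕ} (n : Fin m → ℕ)

/-- The first point `n_1 + ⋯ + n_j` of the box with (zero-based) index `j`; for `j ≥ m` this is
the total number of points. -/
def boxStart (j : ℕ) : ℕ := ∑ i : Fin m with i.val < j, n i

@[simp] lemma boxStart_zero : boxStart n 0 = 0 := by simp [boxStart]

lemma boxStart_last : boxStart n m = ∑ j, n j := by simp [boxStart]

lemma boxStart_mono : Monotone (boxStart n) := fun _ _ h =>
  sum_le_sum_of_subset fun i hi => by
    rw [mem_filter] at hi ⊢
    exact ⟨hi.1, hi.2.trans_le h⟩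

lemma sum_Iio_eq_boxStart (j : Fin m) : ∑ k ∈ Iio j, n k = boxStart n j := by
  simp only [boxStart, ← Fin.lt_def, filter_gt_eq_Iio]

lemma sum_Iic_eq_boxStart (j : Fin m) : ∑ k ∈ Iic j, n k = boxStart n (j + 1) := by
  simp only [boxStart, Nat.lt_succ_iff, ← Fin.le_def, filter_ge_eq_Iic]

lemma boxStart_succ (j : Fin m) : boxStart n (j + 1) = boxStart n j + n j := by
  rw [← sum_Iic_eq_boxStart, ← sum_Iio_eq_boxStart, ← Iio_insert, sum_insert (by simp), add_comm]

variable {n} {i l : Fin (∑ j, n j)}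

lemma mem_box_iff {j : Fin m} : i ∈ box n j ↔ boxStart n j ≤ i ∧ (i : ℕ) < boxStart n (j + 1) := by
  simp only [box, sum_Iio_eq_boxStart, sum_Iic_eq_boxStart, mem_filter, mem_univ, true_and]

lemma exists_mem_box (i : Fin (∑ j, n j)) : ∃ j, i ∈ box n j := by
  have hm : (i : ℕ) < boxStart n m := (boxStart_last n).symm ▸ i.2
  have hex : ∃ j, (i : ℕ) < boxStart n j := ⟨m, hm⟩
  obtain ⟨j, hj⟩ : ∃ j, Nat.find hex = j + 1 :=
    Nat.exists_eq_succ_of_ne_zero fun h => by simpa [h] using Nat.find_spec hex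
  have hjm : j + 1 ≤ m := hj ▸ Nat.find_min' hex hm
  have hstart : boxStart n j ≤ i := not_lt.1 (Nat.find_min hex (hj ▸ j.lt_succ_self))
  exact ⟨⟨j, hjm⟩, mem_box_iff.2 ⟨hstart, hj ▸ Nat.find_spec hex⟩⟩

lemma separated_iff_forall_box (hil : i < l) :
    Separated (boxStart n) i l ↔ ∀ j, ¬ (i ∈ box n j ∧ l ∈ box n j) := by
  obtain ⟨j, hj⟩ := exists_mem_box l
  have hj' := mem_box_iff.1 hj
  rw [separated_iff_lt (boxStart_mono n) hj'.1 hj'.2]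
  constructor
  · rintro hij k ⟨hi, hl⟩
    rw [mem_box_iff] at hi hl
    have := (separated_iff_lt (boxStart_mono n) hl.1 hl.2 i).1 ⟨j, hij, hj'.1⟩
    omega
  · intro h
    by_contra hc
    exact h j ⟨mem_box_iff.2 ⟨not_lt.1 hc, lt_trans hil hj'.2⟩, hj⟩

end Boxes

section PerfectMatchings

variable {N : ℕ}

/-- The coercion of pairs of elements of `Fin N` to pairs of natural numbers. -/
def pairVal (N : ℕ) : Fin N × Fin N ↪ ℕ × ℕ := Fin.valEmbedding.prodMap Fin.valEmbedding

@[simp] lemma pairVal_apply (e : Fin N × Fin N) : pairVal N e = ((e.1 : ℕ), (e.2 : ℕ)) := rfl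

lemma eq_of_pair_eq_pair {α : Type*} [LinearOrder α] {e f : α × α} (he : e.1 < e.2)
    (hf : f.1 < f.2) (h : ({e.1, e.2} : Finset α) = {f.1, f.2}) : e = f := by
  simp only [← coe_inj, coe_pair, Set.pair_eq_pair_iff] at h
  rcases h with ⟨h₁, h₂⟩ | ⟨h₁, h₂⟩
  · exact Prod.ext h₁ h₂
  · exact absurd (h₁ ▸ h₂ ▸ he) hf.not_gt

variable {M M' : Finpartition (univ : Finset (Fin N))}

lemma mem_arcs {e : Fin N × Fin N} : e ∈ arcs M ↔ e.1 < e.2 ∧ {e.1, e.2} ∈ M.parts := by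
  simp [arcs]

lemma eq_of_mem_arcs {e f : Fin N × Fin N} (he : e ∈ arcs M) (hf : f ∈ arcs M) {a : Fin N}
    (hae : a ∈ ({e.1, e.2} : Finset (Fin N))) (haf : a ∈ ({f.1, f.2} : Finset (Fin N))) :
    e = f := by
  rw [mem_arcs] at he hf
  exact eq_of_pair_eq_pair he.1 hf.1 (M.eq_of_mem_parts he.2 hf.2 hae haf)

namespace IsPerfectMatching

lemma mem_parts_iff (hM : IsPerfectMatching M) (B : Finset (Fin N)) :
    B ∈ M.parts ↔ ∃ e ∈ arcs M, B = {e.1, e.2} := by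
  constructor
  · intro hB
    obtain ⟨a, b, hab, rfl⟩ := card_eq_two.1 (hM B hB)
    rcases hab.lt_or_gt with h | h
    · exact ⟨(a, b), mem_arcs.2 ⟨h, hB⟩, rfl⟩
    · exact ⟨(b, a), mem_arcs.2 ⟨h, by rwa [pair_comm]⟩, pair_comm _ _⟩
  · rintro ⟨e, he, rfl⟩
    exact (mem_arcs.1 he).2

lemma openPts_arcs (hM : IsPerfectMatching M) : openPts N ((arcs M).map (pairVal N)) = ∅ := by
  refine eq_empty_of_forall_notMem fun i hi => ?_
  obtain ⟨hiN, hi⟩ := mem_openPts.1 hi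
  obtain ⟨B, hB, hiB⟩ := M.exists_mem (mem_univ (⟨i, hiN⟩ : Fin N))
  obtain ⟨e, he, rfl⟩ := (hM.mem_parts_iff B).1 hB
  refine hi _ (mem_map_of_mem _ he) ?_
  simpa only [mem_insert, mem_singleton, Fin.ext_iff, pairVal_apply] using hiB

lemma arcs_injective (hM : IsPerfectMatching M) (hM' : IsPerfectMatching M')
    (h : arcs M = arcs M') : M = M' := by
  ext B
  rw [hM.mem_parts_iff, hM'.mem_parts_iff, h]

lemma openCr_arcs (hM : IsPerfectMatching M) : openCr N ((arcs M).map (pairVal N)) = cr M := by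
  simp only [openCr, hM.openPts_arcs, filter_empty, card_empty, add_zero, sum_map, filter_map,
    card_map, cr, card_filter, sum_product]
  rfl

lemma isInhomogeneous_iff {m : ℕ} {n : Fin m → ℕ}
    {M : Finpartition (univ : Finset (Fin (∑ j, n j)))} (hM : IsPerfectMatching M) :
    IsInhomogeneous n M ↔ ∀ e ∈ arcs M, Separated (boxStart n) e.1 e.2 := by
  constructor
  · intro hI e he
    obtain ⟨hlt, hB⟩ := mem_arcs.1 he
    exact (separated_iff_forall_box hlt).2 (hI _ hB _ (by simp) _ (by simp) hlt.ne)
  · intro hS B hB x hx y hy hxy j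
    obtain ⟨e, he, rfl⟩ := (hM.mem_parts_iff B).1 hB
    have := (separated_iff_forall_box (mem_arcs.1 he).1).1 (hS e he) j
    simp only [mem_insert, mem_singleton] at hx hy
    grind

end IsPerfectMatching

lemma isPartialMatching_arcs {r : ℕ → ℕ → Prop} :
    IsPartialMatching r N ((arcs M).map (pairVal N)) ↔ ∀ e ∈ arcs M, r e.1 e.2 := by
  refine ⟨fun h e he => h.rel _ (mem_map_of_mem _ he), fun hr => ⟨?_, ?_, ?_, ?_⟩⟩ <;>
    simp only [forall_mem_map, pairVal_apply]
  · exact fun e he => (mem_arcs.1 he).1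
  · exact fun e _ => e.2.2
  · exact hr
  · intro e he f hf a hae haf
    obtain ⟨a, rfl⟩ : ∃ b : Fin N, (b : ℕ) = a := by
      rcases hae with rfl | rfl
      exacts [⟨_, rfl⟩, ⟨_, rfl⟩]
    simp only [Fin.val_inj] at hae haf
    rw [eq_of_mem_arcs he hf (by simpa using hae) (by simpa using haf)]

lemma exists_arcs_eq {E : Finset (Fin N × Fin N)} (hlt : ∀ e ∈ E, e.1 < e.2)
    (hE : ∀ a, ∃! e, e ∈ E ∧ (a = e.1 ∨ a = e.2)) :
    ∃ M : Finpartition (univ : Finset (Fin N)), IsPerfectMatching M ∧ arcs M = E := by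
  let M : Finpartition (univ : Finset (Fin N)) :=
    Finpartition.ofExistsUnique (E.image fun e => {e.1, e.2}) (fun _ _ => subset_univ _)
      (fun a _ => by
        obtain ⟨e, ⟨he, hae⟩, he_unique⟩ := hE a
        refine ⟨{e.1, e.2}, ⟨mem_image_of_mem _ he, by simpa using hae⟩, ?_⟩
        rintro _ ⟨hB, haB⟩
        obtain ⟨f, hf, rfl⟩ := mem_image.1 hB
        rw [he_unique f ⟨hf, by simpa using haB⟩])
      (by simp)
  have mem_parts : ∀ B, B ∈ M.parts ↔ ∃ e ∈ E, {e.1, e.2} = B := fun _ => mem_image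
  refine ⟨M, fun B hB => ?_, ext fun e => ?_⟩
  · obtain ⟨e, he, rfl⟩ := (mem_parts B).1 hB
    exact card_pair (hlt e he).ne
  · rw [mem_arcs, mem_parts]
    constructor
    · rintro ⟨he, f, hf, h⟩
      rwa [← eq_of_pair_eq_pair (hlt f hf) he h]
    · exact fun he => ⟨hlt e he, e, he, rfl⟩

lemma exists_map_pairVal_eq {A : Finset (ℕ × ℕ)} (hA : A ⊆ range N ×ˢ range N) :
    ∃ E : Finset (Fin N × Fin N), E.map (pairVal N) = A := by
  have hA_map : A ⊆ univ.map (pairVal N) := fun e he => by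
    obtain ⟨h₁, h₂⟩ := mem_product.1 (hA he)
    exact mem_map.2 ⟨(⟨e.1, mem_range.1 h₁⟩, ⟨e.2, mem_range.1 h₂⟩), mem_univ _, rfl⟩
  obtain ⟨E, -, hE⟩ := subset_map_iff.1 hA_map
  exact ⟨E, hE.symm⟩

lemma IsPartialMatching.exists_arcs_eq {r : ℕ → ℕ → Prop} {A : Finset (ℕ × ℕ)}
    (hA : IsPartialMatching r N A) (hopen : openPts N A = ∅) :
    ∃ M : Finpartition (univ : Finset (Fin N)), IsPerfectMatching M ∧
      (arcs M).map (pairVal N) = A := by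
  obtain ⟨E, rfl⟩ := exists_map_pairVal_eq fun e he => mem_product.2
    ⟨mem_range.2 ((hA.fst_lt_snd e he).trans (hA.snd_lt e he)), mem_range.2 (hA.snd_lt e he)⟩
  have hE : ∀ a, ∃! e, e ∈ E ∧ (a = e.1 ∨ a = e.2) := by
    intro a
    have ha : (a : ℕ) ∉ openPts N (E.map (pairVal N)) := by simp [hopen]
    simp only [mem_openPts, a.2, true_and, forall_mem_map, pairVal_apply, Fin.val_inj] at ha
    push Not at ha
    obtain ⟨e, he, hae⟩ := ha
    refine ⟨e, ⟨he, hae⟩, fun f hf => (pairVal N).injective ?_⟩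
    exact hA.eq_of_endpoint _ (mem_map_of_mem _ hf.1) _ (mem_map_of_mem _ he) a
      (by simpa [Fin.val_inj] using hf.2) (by simpa [Fin.val_inj] using hae)
  obtain ⟨M, hM, hME⟩ := QHermite.exists_arcs_eq
    (fun e he => hA.fst_lt_snd _ (mem_map_of_mem _ he)) hE
  exact ⟨M, hM, by rw [hME]⟩

lemma K_eq_sum_partialMatchings {m : ℕ} (n : Fin m → ℕ) (q : ℝ) :
    K n q = ∑ A ∈ partialMatchings (Separated (boxStart n)) (∑ j, n j)
      with openPts (∑ j, n j) A = ∅, q ^ openCr (∑ j, n j) A := by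
  have mem_inhom : ∀ M, M ∈ inhomMatchings n ↔ IsPerfectMatching M ∧ IsInhomogeneous n M :=
    fun M => by simp [inhomMatchings]
  refine sum_bij (fun M _ => (arcs M).map (pairVal _)) ?_ ?_ ?_ ?_
  · intro M hM
    obtain ⟨hM, hI⟩ := (mem_inhom M).1 hM
    rw [mem_filter, mem_partialMatchings, isPartialMatching_arcs, ← hM.isInhomogeneous_iff]
    exact ⟨hI, hM.openPts_arcs⟩
  · intro M hM M' hM' h
    exact ((mem_inhom M).1 hM).1.arcs_injective ((mem_inhom M').1 hM').1 (map_injective _ h)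
  · intro A hA
    rw [mem_filter, mem_partialMatchings] at hA
    obtain ⟨M, hM, rfl⟩ := hA.1.exists_arcs_eq hA.2
    exact ⟨M, (mem_inhom M).2 ⟨hM, hM.isInhomogeneous_iff.2 (isPartialMatching_arcs.1 hA.1)⟩, rfl⟩
  · intro M hM
    rw [((mem_inhom M).1 hM).1.openCr_arcs]

end PerfectMatchings

section RescaledHermite

lemma rescaledHermite_zero (q x : ℝ) : rescaledHermite q 0 x = 1 := by
  simp [rescaledHermite, contHermite]

lemma contHermite_succ (q : ℝ) (n : ℕ) :
    contHermite q (n + 1) = 2 * X * contHermite q n - C (1 - q ^ n) * contHermite q (n - 1) := by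
  cases n with
  | zero => simp [contHermite]
  | succ n => rfl

lemma rescaledHermite_succ {q : ℝ} (hq : q < 1) (n : ℕ) (x : ℝ) :
    rescaledHermite q (n + 1) x =
      x * rescaledHermite q n x - qInt q n * rescaledHermite q (n - 1) x := by
  have hsq : √(1 - q) ^ 2 = 1 - q := Real.sq_sqrt (sub_nonneg.2 hq.le)
  have hne : √(1 - q) ≠ 0 := (Real.sqrt_pos.2 (sub_pos.2 hq)).ne'
  cases n with
  | zero =>
    simp only [rescaledHermite, contHermite, eval_mul, eval_ofNat, eval_X, eval_one, qInt_zero]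
    field_simp
    ring
  | succ n =>
    simp only [rescaledHermite, contHermite_succ q (n + 1), Nat.add_sub_cancel, eval_sub,
      eval_mul, eval_C, eval_X, eval_ofNat, ← one_sub_mul_qInt]
    generalize √(1 - q) = a at hsq hne
    rw [← hsq]
    field_simp
    ring

lemma prod_rescaledHermite {q : ℝ} (hq : q < 1) {m : ℕ} (n : Fin m → ℕ) (x : ℝ) :
    ∏ j, rescaledHermite q (n j) x =
      ∑ A ∈ partialMatchings (Separated (boxStart n)) (∑ j, n j),
        q ^ openCr (∑ j, n j) A * rescaledHermite q #(openPts (∑ j, n j) A) x := by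
  rw [← boxStart_last, ← prod_eq_sum_partialMatchings (η := fun k => rescaledHermite q k x)
    (rescaledHermite_zero q x) (rescaledHermite_succ hq · x) (boxStart_mono n) (boxStart_zero n),
    prod_range]
  simp only [boxStart_succ, Nat.add_sub_cancel_left]

end RescaledHermite

section GaussBinom

variable {R : Type*} [CommRing R]

/-- The finite `q`-shifted factorial `(q; q)_n`. -/
def qPoch (q : R) (n : ℕ) : R := ∏ k ∈ range n, (1 - q ^ (k + 1))

/-- The Gaussian binomial coefficient `[n, k]_q`, by the `q`-Pascal rule, so that no division
is needed. -/
def gaussBinom (q : R) : ℕ → ℕ → R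
  | _, 0 => 1
  | 0, _ + 1 => 0
  | n + 1, k + 1 => gaussBinom q n k + q ^ (k + 1) * gaussBinom q n (k + 1)

variable (q : R)

lemma qPoch_zero : qPoch q 0 = 1 := prod_range_zero _

lemma qPoch_succ (n : ℕ) : qPoch q (n + 1) = qPoch q n * (1 - q ^ (n + 1)) :=
  prod_range_succ _ _

lemma gaussBinom_zero_right (n : ℕ) : gaussBinom q n 0 = 1 := by
  cases n <;> rfl

lemma gaussBinom_succ_succ (n k : ℕ) :
    gaussBinom q (n + 1) (k + 1) = gaussBinom q n k + q ^ (k + 1) * gaussBinom q n (k + 1) := rfl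

lemma gaussBinom_eq_zero {n k : ℕ} (h : n < k) : gaussBinom q n k = 0 := by
  induction n generalizing k with
  | zero =>
    obtain ⟨k, rfl⟩ := Nat.exists_eq_succ_of_ne_zero h.ne'
    rfl
  | succ n ih =>
    obtain ⟨k, rfl⟩ := Nat.exists_eq_succ_of_ne_zero (Nat.ne_zero_of_lt h)
    rw [Nat.succ_eq_add_one, gaussBinom_succ_succ, ih (by lia), ih (by lia), mul_zero, add_zero]

lemma gaussBinom_self (n : ℕ) : gaussBinom q n n = 1 := by
  induction n with
  | zero => rfl
  | succ n ih => rw [gaussBinom_succ_succ, ih, gaussBinom_eq_zero q n.lt_succ_self, mul_zero,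
      add_zero]

lemma gaussBinom_succ_succ' {n k : ℕ} (h : k ≤ n) :
    gaussBinom q (n + 1) (k + 1) = gaussBinom q n (k + 1) + q ^ (n - k) * gaussBinom q n k := by
  induction n generalizing k with
  | zero =>
    obtain rfl : k = 0 := by lia
    simp only [gaussBinom]
    ring
  | succ n ih =>
    rcases h.eq_or_lt with rfl | hk
    · simp only [gaussBinom_self, gaussBinom_eq_zero q (Nat.lt_succ_self _), Nat.sub_self]
      ring
    cases k with
    | zero =>
      have := ih (Nat.zero_le n)
      simp only [gaussBinom_succ_succ q (n + 1), gaussBinom_succ_succ q n, gaussBinom_zero_right,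
        Nat.sub_zero] at this ⊢
      linear_combination q * this
    | succ k =>
      have hpow : q ^ (k + 2) * q ^ (n - (k + 1)) = q ^ (n - k) * q ^ (k + 1) := by
        rw [← pow_add, ← pow_add]
        congr 1
        lia
      rw [gaussBinom_succ_succ q (n + 1), Nat.add_sub_add_right]
      linear_combination ih (k := k) (by lia) + q ^ (k + 2) * ih (k := k + 1) (by lia) +
        gaussBinom q n (k + 1) * hpow - gaussBinom_succ_succ q n (k + 1) -
        q ^ (n - k) * gaussBinom_succ_succ q n k

lemma one_sub_pow_mul_gaussBinom_succ_succ (n k : ℕ) :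
    (1 - q ^ (k + 1)) * gaussBinom q (n + 1) (k + 1) = (1 - q ^ (n + 1)) * gaussBinom q n k := by
  rcases le_or_gt k n with h | h
  · have hpow : q ^ (k + 1) * q ^ (n - k) = q ^ (n + 1) := by
      rw [← pow_add]
      congr 1
      lia
    linear_combination gaussBinom_succ_succ q n k - q ^ (k + 1) * gaussBinom_succ_succ' q h -
      gaussBinom q n k * hpow
  · rw [gaussBinom_eq_zero q h, gaussBinom_eq_zero q (Nat.succ_lt_succ h), mul_zero, mul_zero]

lemma gaussBinom_add_mul (k j : ℕ) :
    gaussBinom q (k + j) k * (qPoch q k * qPoch q j) = qPoch q (k + j) := by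
  induction k with
  | zero => rw [gaussBinom_zero_right, qPoch_zero, one_mul, one_mul, zero_add]
  | succ k ih =>
    rw [show k + 1 + j = k + j + 1 by ring, qPoch_succ, qPoch_succ]
    linear_combination qPoch q k * qPoch q j * one_sub_pow_mul_gaussBinom_succ_succ q (k + j) k +
      (1 - q ^ (k + j + 1)) * ih

/-- The Rogers–Szegő recurrence. -/
lemma sum_gaussBinom_smul_add_two {M : Type*} [AddCommGroup M] [Module R M] (n : ℕ) (f : ℕ → M) :
    ∑ k ∈ range (n + 3), gaussBinom q (n + 2) k • f k =
      ∑ k ∈ range (n + 2), gaussBinom q (n + 1) k • (f k + f (k + 1)) -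
        (1 - q ^ (n + 1)) • ∑ k ∈ range (n + 1), gaussBinom q n k • f (k + 1) := by
  have hcoeff (k : ℕ) : gaussBinom q (n + 2) (k + 1) = gaussBinom q (n + 1) (k + 1) +
      gaussBinom q (n + 1) k - (1 - q ^ (n + 1)) * gaussBinom q n k := by
    linear_combination gaussBinom_succ_succ q (n + 1) k -
      one_sub_pow_mul_gaussBinom_succ_succ q n k
  have hextend (n : ℕ) (f : ℕ → M) : ∑ k ∈ range (n + 1), gaussBinom q n k • f k =
      ∑ k ∈ range (n + 2), gaussBinom q n k • f k := by
    rw [sum_range_succ _ (n + 1), gaussBinom_eq_zero q n.lt_succ_self, zero_smul, add_zero]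
  have hshift : ∑ k ∈ range (n + 2), gaussBinom q (n + 1) k • f k =
      f 0 + ∑ k ∈ range (n + 2), gaussBinom q (n + 1) (k + 1) • f (k + 1) := by
    rw [hextend, sum_range_succ', gaussBinom_zero_right, one_smul, add_comm]
  simp only [smul_add, sum_add_distrib]
  rw [hshift, hextend n, sum_range_succ', gaussBinom_zero_right, one_smul, smul_sum]
  simp only [hcoeff, add_smul, sub_smul, sum_add_distrib, sum_sub_distrib, smul_smul]
  abel

end GaussBinom

section Rogers

lemma contHermite_eq_sum_T (q : ℝ) (n : ℕ) :
    contHermite q n = ∑ k ∈ range (n + 1), gaussBinom q n k • T ℝ (n - 2 * k) := by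
  induction n using Nat.twoStepInduction with
  | zero => simp [contHermite, gaussBinom]
  | one =>
    simp [contHermite, sum_range_succ, gaussBinom_zero_right, gaussBinom_self, two_mul]
  | more n ih₀ ih₁ =>
    have hT (k : ℕ) : T ℝ ((n + 2 : ℕ) - 2 * k) + T ℝ (n - 2 * k) =
        2 * X * T ℝ ((n + 1 : ℕ) - 2 * k) := by
      have := T_add_one ℝ ((n + 1 : ℕ) - 2 * k)
      rw [show ((n + 2 : ℕ) - 2 * k : ℤ) = (n + 1 : ℕ) - 2 * k + 1 by push_cast; ring, this,
        show (n - 2 * k : ℤ) = (n + 1 : ℕ) - 2 * k - 1 by push_cast; ring, sub_add_cancel]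
    have hindex (k : ℕ) : ((n + 2 : ℕ) - 2 * (k + 1 : ℕ) : ℤ) = n - 2 * k := by push_cast; ring
    rw [sum_gaussBinom_smul_add_two q n fun k : ℕ => T ℝ ((n + 2 : ℕ) - 2 * k)]
    simp only [hindex, hT, ← mul_smul_comm, ← mul_sum, ← ih₀, ← ih₁]
    rw [contHermite, smul_eq_C_mul]

end Rogers

section Theta

/-- The triangular number `j (j - 1) / 2`, which is nonnegative for every integer `j`. -/
def tri (j : ℤ) : ℕ := (j * (j - 1) / 2).toNat

lemma two_mul_tri (j : ℤ) : 2 * (tri j : ℤ) = j * (j - 1) := by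
  have hnonneg : 0 ≤ j * (j - 1) := by
    rcases le_or_gt j 0 with h | h <;> nlinarith
  have hdvd : 2 ∣ j * (j - 1) := by
    simpa only [sub_add_cancel, mul_comm] using (Int.even_mul_succ_self (j - 1)).two_dvd
  rw [tri]
  lia

lemma tri_one_sub (j : ℤ) : tri (1 - j) = tri j := by
  have := two_mul_tri j
  have := two_mul_tri (1 - j)
  grind

lemma tri_add_one (j : ℤ) : (tri (j + 1) : ℤ) = tri j + j := by
  have := two_mul_tri j
  have := two_mul_tri (j + 1)
  grind

variable {R : Type*} [CommRing R] (q : R)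

/-- The finite theta product `(z; q)_M (q / z; q)_N z ^ N` of the Jacobi triple product. -/
noncomputable def thetaPoly (M N : ℕ) : R[X] :=
  (∏ k ∈ range M, (1 - C (q ^ k) * X)) * ∏ k ∈ range N, (X - C (q ^ (k + 1)))

lemma thetaPoly_succ_left (M N : ℕ) :
    thetaPoly q (M + 1) N = thetaPoly q M N - C (q ^ M) * (X * thetaPoly q M N) := by
  rw [thetaPoly, prod_range_succ, thetaPoly]
  ring

lemma thetaPoly_succ_right (M N : ℕ) :
    thetaPoly q M (N + 1) = X * thetaPoly q M N - C (q ^ (N + 1)) * thetaPoly q M N := by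
  rw [thetaPoly, prod_range_succ, thetaPoly]
  ring

lemma coeff_thetaPoly_zero_left (N i : ℕ) :
    (thetaPoly q 0 N).coeff i = gaussBinom q N i * (-1) ^ (i + N) * q ^ tri (i - N) := by
  induction N generalizing i with
  | zero => cases i <;> simp [thetaPoly, coeff_one, gaussBinom, tri]
  | succ N ih =>
    rw [thetaPoly_succ_right, coeff_sub, coeff_C_mul, ih]
    have htri : N + 1 + tri (i - N) = i + tri (i - (N + 1 : ℕ)) := by
      have := tri_add_one (i - (N + 1 : ℕ))
      rw [show (i : ℤ) - (N + 1 : ℕ) + 1 = i - N by push_cast; ring] at this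
      lia
    have hpow : q ^ (N + 1) * q ^ tri (i - N) = q ^ i * q ^ tri (i - (N + 1 : ℕ)) := by
      rw [← pow_add, htri, pow_add]
    cases i with
    | zero =>
      rw [coeff_X_mul_zero, gaussBinom_zero_right, gaussBinom_zero_right]
      linear_combination -(-1) ^ N * hpow
    | succ i =>
      rw [coeff_X_mul, ih, gaussBinom_succ_succ,
        show (i : ℤ) - N = (i + 1 : ℕ) - (N + 1 : ℕ) by push_cast; ring]
      linear_combination -gaussBinom q N (i + 1) * (-1) ^ (i + 1 + N) * hpow

/-- The finite form of the Jacobi triple product identity. -/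
lemma coeff_thetaPoly (M N i : ℕ) :
    (thetaPoly q M N).coeff i =
      gaussBinom q (M + N) i * (-1) ^ (i + N) * q ^ tri (i - N) := by
  induction M generalizing i with
  | zero => rw [coeff_thetaPoly_zero_left, zero_add]
  | succ M ih =>
    rw [thetaPoly_succ_left, coeff_sub, coeff_C_mul, ih, Nat.add_right_comm]
    cases i with
    | zero =>
      rw [coeff_X_mul_zero, gaussBinom_zero_right, gaussBinom_zero_right, mul_zero, sub_zero]
    | succ i =>
      rw [coeff_X_mul, ih]
      rcases le_or_gt i (M + N) with hi | hi
      · have htri : M + tri (i - N) = M + N - i + tri ((i + 1 : ℕ) - N) := by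
          have := tri_add_one (i - N)
          rw [show (i : ℤ) - N + 1 = (i + 1 : ℕ) - N by push_cast; ring] at this
          lia
        have hpow : q ^ M * q ^ tri (i - N) = q ^ (M + N - i) * q ^ tri ((i + 1 : ℕ) - N) := by
          rw [← pow_add, htri, pow_add]
        rw [gaussBinom_succ_succ' q hi]
        linear_combination -gaussBinom q (M + N) i * (-1) ^ (i + N) * hpow
      · simp only [gaussBinom_eq_zero q hi, gaussBinom_eq_zero q (Nat.lt_succ_of_lt hi),
          gaussBinom_eq_zero q (Nat.succ_lt_succ hi), zero_mul, mul_zero, sub_zero]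

lemma sum_gaussBinom_mul_tri (M N : ℕ) :
    ∑ k ∈ range (M + N + 1), gaussBinom q (M + N) k * ((-1) ^ (k + N) * q ^ tri (k - N)) =
      (thetaPoly q M N).eval 1 := by
  have hdeg : (thetaPoly q M N).natDegree < M + N + 1 :=
    Nat.lt_succ_of_le <| natDegree_le_iff_coeff_eq_zero.2 fun i hi => by
      rw [coeff_thetaPoly, gaussBinom_eq_zero q hi, zero_mul, zero_mul]
  rw [eval_eq_sum_range' hdeg]
  simp only [coeff_thetaPoly, one_pow, mul_one, mul_assoc]

lemma eval_one_thetaPoly_succ (M N : ℕ) : (thetaPoly q (M + 1) N).eval 1 = 0 := by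
  simp [thetaPoly, prod_range_succ', eval_mul]

/-- The orthogonality of `H_{2r}` to `H_0`, before the Fourier coefficients of the weight are
normalised. -/
lemma sum_gaussBinom_mul_tri_add_tri (r : ℕ) :
    ∑ k ∈ range (2 * r + 1), gaussBinom q (2 * r) k *
      ((-1) ^ (k + r) * (q ^ tri (r - k) + q ^ tri (k - r))) = if r = 0 then 2 else 0 := by
  cases r with
  | zero => norm_num [gaussBinom, tri]
  | succ r =>
    have h₁ := sum_gaussBinom_mul_tri q (r + 1) (r + 1)
    have h₂ := sum_gaussBinom_mul_tri q (r + 1 + 1) r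
    rw [eval_one_thetaPoly_succ, show r + 1 + (r + 1) = 2 * (r + 1) by ring] at h₁
    rw [eval_one_thetaPoly_succ, show r + 1 + 1 + r = 2 * (r + 1) by ring] at h₂
    have htri (k : ℕ) : tri (k - r) = tri ((r + 1 : ℕ) - k) := by
      rw [← tri_one_sub]
      congr 1
      push_cast
      ring
    rw [if_neg r.succ_ne_zero, ← sub_self (0 : R)]
    nth_rw 1 [← h₁]
    rw [← h₂, ← sum_sub_distrib]
    refine sum_congr rfl fun k _ => ?_
    rw [htri]
    ring

end Theta

open Filter Topology MeasureTheory

section Limits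

variable {q : ℝ}

lemma one_sub_pow_succ_pos (hq : |q| < 1) (k : ℕ) : 0 < 1 - q ^ (k + 1) :=
  sub_pos.2 <| (le_abs_self _).trans_lt <| by
    simpa only [abs_pow] using pow_lt_one₀ (abs_nonneg q) hq k.succ_ne_zero

lemma gaussBinom_add_eq_div (hq : |q| < 1) (k j : ℕ) :
    gaussBinom q (k + j) k = qPoch q (k + j) / (qPoch q k * qPoch q j) := by
  have hpos (n : ℕ) : 0 < qPoch q n := prod_pos fun k _ => one_sub_pow_succ_pos hq k
  rw [eq_div_iff (mul_pos (hpos k) (hpos j)).ne', gaussBinom_add_mul]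

lemma summable_norm_neg_pow_succ (hq : |q| < 1) : Summable fun k : ℕ => ‖-q ^ (k + 1)‖ := by
  simpa only [norm_neg, norm_pow] using!
    (summable_nat_add_iff 1).2 (summable_geometric_of_lt_one (abs_nonneg q) hq)

lemma tendsto_qPoch (hq : |q| < 1) : Tendsto (qPoch q) atTop (𝓝 (qPochInfty q)) := by
  have h := (multipliable_one_add_of_summable (summable_norm_neg_pow_succ hq)).hasProd
  simp only [← sub_eq_add_neg] at h
  exact h.tendsto_prod_nat

lemma qPochInfty_ne_zero (hq : |q| < 1) : qPochInfty q ≠ 0 := by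
  simpa only [← sub_eq_add_neg] using! tprod_one_add_ne_zero_of_summable
    (fun k => by simpa only [← sub_eq_add_neg] using (one_sub_pow_succ_pos hq k).ne')
    (summable_norm_neg_pow_succ hq)

lemma tendsto_gaussBinom_add (hq : |q| < 1) {ι : Type*} {l : Filter ι} {s t : ι → ℕ}
    (hs : Tendsto s l atTop) (ht : Tendsto t l atTop) :
    Tendsto (fun i => gaussBinom q (s i + t i) (s i)) l (𝓝 (qPochInfty q)⁻¹) := by
  have hP := qPochInfty_ne_zero hq
  have hlim := tendsto_qPoch hq
  have := (hlim.comp (hs.atTop_add_atTop ht)).div ((hlim.comp hs).mul (hlim.comp ht))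
    (mul_ne_zero hP hP)
  rw [div_mul_cancel_left₀ hP] at this
  simpa only [gaussBinom_add_eq_div hq] using! this

lemma tendsto_toNat_natCast_add_atTop (j : ℤ) :
    Tendsto (fun N : ℕ => ((N : ℤ) + j).toNat) atTop atTop :=
  tendsto_atTop_mono (fun N => by lia) (tendsto_sub_atTop_nat j.natAbs)

lemma neg_one_pow_toNat_add {N : ℕ} {j : ℤ} (h : 0 ≤ N + j) :
    (-1 : ℝ) ^ ((N + j).toNat + N) = (-1) ^ j := by
  rw [← zpow_natCast, Nat.cast_add, Int.toNat_of_nonneg h, show (N + j + N : ℤ) = j + 2 * N by ring,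
    zpow_add₀ (by norm_num), zpow_mul]
  norm_num

lemma tendsto_coeff_thetaPoly (hq : |q| < 1) (j : ℤ) :
    Tendsto (fun N : ℕ => (thetaPoly q (N + 1) N).coeff (N + j).toNat) atTop
      (𝓝 ((qPochInfty q)⁻¹ * (-1) ^ j * q ^ tri j)) := by
  have hlim := tendsto_gaussBinom_add hq (tendsto_toNat_natCast_add_atTop j)
    (tendsto_toNat_natCast_add_atTop (1 - j))
  refine ((hlim.mul_const ((-1) ^ j)).mul_const (q ^ tri j)).congr' ?_
  filter_upwards [eventually_ge_atTop j.natAbs] with N hN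
  rw [coeff_thetaPoly, neg_one_pow_toNat_add (by lia),
    show ((N + j).toNat : ℤ) - N = j by lia,
    show (N + j).toNat + (N + (1 - j)).toNat = N + 1 + N by lia]

end Limits

section Chebyshev

/-- The linear map sending `X ^ i` to the Chebyshev polynomial `T_{2 (i - c)}`, that is, the real
part of the Laurent polynomial `z ^ (-c) * p` at `z = e ^ (2iθ)`, as a polynomial in `cos θ`. -/
noncomputable def chebyshevSum {R : Type*} [CommRing R] (c : ℤ) : R[X] →ₗ[R] R[X] :=
  lsum fun i => LinearMap.toSpanSingleton R R[X] (T R (2 * (i - c)))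

lemma chebyshevSum_monomial {R : Type*} [CommRing R] (c : ℤ) (i : ℕ) (a : R) :
    chebyshevSum c (monomial i a) = C a * T R (2 * (i - c)) := by
  simp [chebyshevSum, lsum_apply, sum_monomial_index, smul_eq_C_mul]

/-- At a point `X = e ^ (2iθ)` of the unit circle, `(1 - a X) (1 - a / X)` has the real value
`1 - 2 a cos (2θ) + a ^ 2`, and `cos (2θ) = 2 cos ^ 2 θ - 1`. -/
lemma chebyshevSum_add_one_mul {R : Type*} [CommRing R] (c : ℤ) (a : R) (p : R[X]) :
    chebyshevSum (c + 1) ((1 - C a * X) * (X - C a) * p) =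
      (1 + (2 - 4 * X ^ 2) * C a + C (a ^ 2)) * chebyshevSum c p := by
  induction p using Polynomial.induction_on' with
  | add p r hp hr => rw [mul_add, map_add, hp, hr, map_add, mul_add]
  | monomial i b =>
    have hexpand : (1 - C a * X) * (X - C a) * monomial i b =
        monomial (i + 1) ((1 + a ^ 2) * b) - monomial (i + 2) (a * b) - monomial i (a * b) := by
      simp only [← C_mul_X_pow_eq_monomial, C_mul, C_add, C_pow, C_1]
      ring
    have hT := T_mul_T R 2 (2 * (i - c))
    rw [T_two, show 2 + 2 * (i - c) = 2 * ((i + 2 : ℕ) - (c + 1)) by push_cast; ring,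
      ← T_neg R (2 - _), show -(2 - 2 * (i - c)) = 2 * (i - (c + 1)) by ring] at hT
    rw [hexpand, map_sub, map_sub]
    simp only [chebyshevSum_monomial, C_mul, C_add, C_pow, C_1]
    rw [show ((i + 1 : ℕ) - (c + 1) : ℤ) = i - c by push_cast; ring]
    linear_combination C a * C b * hT

lemma integral_T_measureT (k : ℤ) :
    ∫ x, (T ℝ k).eval x ∂measureT = if k = 0 then Real.pi else 0 := by
  split_ifs with hk
  · rw [hk, integral_eval_T_real_measureT_zero]
  · exact integral_eval_T_real_measureT_of_ne_zero hk

lemma integrable_eval_measureT (p : ℝ[X]) : Integrable (fun x => p.eval x) measureT :=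
  integrable_measureT p.continuous.continuousOn

lemma integral_chebyshevSum_mul_T (p : ℝ[X]) {c j : ℤ} (h : |j| ≤ c) :
    ∫ x, (chebyshevSum c p * T ℝ (2 * j)).eval x ∂measureT =
      Real.pi / 2 * (p.coeff (c + j).toNat + p.coeff (c - j).toNat) := by
  have hj := abs_le.1 h
  induction p using Polynomial.induction_on' with
  | add p r hp hr =>
    simp only [map_add, add_mul, eval_add, coeff_add]
    rw [integral_add (integrable_eval_measureT _) (integrable_eval_measureT _), hp, hr]
    ring
  | monomial i a =>
    simp only [chebyshevSum_monomial, mul_assoc, eval_mul, eval_C, integral_const_mul,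
      integral_eval_T_real_mul_eval_T_real_measureT, integral_T_measureT, coeff_monomial]
    rw [if_congr (show 2 * (i - c) + 2 * j = 0 ↔ i = (c - j).toNat by lia) rfl rfl,
      if_congr (show 2 * (i - c) - 2 * j = 0 ↔ i = (c + j).toNat by lia) rfl rfl]
    split_ifs <;> ring

lemma tendsto_integral_measureT {ι : Type*} {l : Filter ι} [l.IsCountablyGenerated]
    {F : ι → ℝ → ℝ} {f : ℝ → ℝ} (hF : ∀ᶠ i in l, ContinuousOn (F i) (Set.Icc (-1) 1))
    (h : TendstoUniformlyOn F f l (Set.Icc (-1) 1)) :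
    Tendsto (fun i => ∫ x, F i x ∂measureT) l (𝓝 (∫ x, f x ∂measureT)) := by
  simp only [integral_measureT_eq_integral_cos]
  refine TendstoUniformlyOn.tendsto_intervalIntegral_of_continuousOn
    (F := fun i θ => F i (Real.cos θ)) (hF.mono fun i hi => ?_)
    ((h.comp Real.cos).mono fun θ _ => Real.cos_mem_Icc θ)
  exact hi.comp Real.continuous_cos.continuousOn fun θ _ => Real.cos_mem_Icc θ

end Chebyshev

section WeightProduct

/-- The partial products of `weightProd`. -/
noncomputable def weightPoly {R : Type*} [CommRing R] (q : R) (N : ℕ) : R[X] :=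
  ∏ k ∈ range N, (1 + (2 - 4 * X ^ 2) * C (q ^ k) + C (q ^ (2 * k)))

/-- The infinite product in `weight q x`, in the variable `y = √(1 - q) * x / 2`. -/
noncomputable def weightProd (q y : ℝ) : ℝ :=
  ∏' k : ℕ, (1 + (2 - 4 * y ^ 2) * q ^ k + q ^ (2 * k))

section CommRing

variable {R : Type*} [CommRing R] (q : R)

lemma prod_eq_thetaPoly_mul (N : ℕ) :
    ∏ k ∈ range (N + 1), (1 - C (q ^ k) * X) * (X - C (q ^ k)) =
      thetaPoly q (N + 1) N * (X - 1) := by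
  rw [prod_mul_distrib, prod_range_succ' fun k => X - C (q ^ k), pow_zero, C_1, ← mul_assoc,
    thetaPoly]

lemma weightPoly_eq_chebyshevSum (N : ℕ) :
    weightPoly q N =
      chebyshevSum N (∏ k ∈ range N, (1 - C (q ^ k) * X) * (X - C (q ^ k))) := by
  induction N with
  | zero => simpa [weightPoly] using (chebyshevSum_monomial (R := R) 0 0 1).symm
  | succ N ih =>
    rw [prod_range_succ, mul_comm, Nat.cast_succ, chebyshevSum_add_one_mul, ← ih, ← pow_mul,
      mul_comm N 2, weightPoly, prod_range_succ, mul_comm, weightPoly]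

lemma weightPoly_succ_eq_chebyshevSum (N : ℕ) :
    weightPoly q (N + 1) = chebyshevSum (N + 1) (thetaPoly q (N + 1) N * (X - 1)) := by
  rw [weightPoly_eq_chebyshevSum, prod_eq_thetaPoly_mul, Nat.cast_succ]

lemma coeff_mul_X_sub_one (p : R[X]) (i : ℕ) :
    (p * (X - 1)).coeff (i + 1) = p.coeff i - p.coeff (i + 1) := by
  rw [mul_sub, coeff_sub, coeff_mul_X, mul_one]

end CommRing

variable {q : ℝ}

lemma integral_weightPoly_mul_T {N : ℕ} {j : ℤ} (h : |j| ≤ N) :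
    ∫ x, (weightPoly q (N + 1)).eval x * (T ℝ (2 * j)).eval x ∂measureT =
      Real.pi / 2 *
        ((thetaPoly q (N + 1) N).coeff (N + j).toNat
          - (thetaPoly q (N + 1) N).coeff (N + (j + 1)).toNat
          + ((thetaPoly q (N + 1) N).coeff (N + -j).toNat
          - (thetaPoly q (N + 1) N).coeff (N + (-j + 1)).toNat)) := by
  have htoNat (i : ℤ) (hi : |i| ≤ N) : (N + 1 + i).toNat = (N + i).toNat + 1 ∧
      (N + (i + 1)).toNat = (N + i).toNat + 1 := by
    have := abs_le.1 hi
    lia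
  have h' : |-j| ≤ N := by rwa [abs_neg]
  simp only [← eval_mul]
  rw [weightPoly_succ_eq_chebyshevSum, integral_chebyshevSum_mul_T _ (h.trans (by lia)),
    sub_eq_add_neg _ j, (htoNat j h).1, (htoNat j h).2, (htoNat _ h').1, (htoNat _ h').2,
    coeff_mul_X_sub_one, coeff_mul_X_sub_one]

lemma tendstoUniformlyOn_weightPoly (hq : |q| < 1) :
    TendstoUniformlyOn (fun N y => (weightPoly q N).eval y) (weightProd q) atTop
      (Set.Icc (-1) 1) := by
  have hbound (k : ℕ) (y : ℝ) (hy : y ∈ Set.Icc (-1) 1) :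
      ‖(2 - 4 * y ^ 2) * q ^ k + q ^ (2 * k)‖ ≤ 3 * |q| ^ k := by
    have hy' : |2 - 4 * y ^ 2| ≤ 2 := abs_le.2 (by constructor <;> nlinarith [hy.1, hy.2])
    have hpow : |q| ^ (2 * k) ≤ |q| ^ k :=
      pow_le_pow_of_le_one (abs_nonneg q) hq.le (by lia)
    calc ‖(2 - 4 * y ^ 2) * q ^ k + q ^ (2 * k)‖
        ≤ |2 - 4 * y ^ 2| * |q| ^ k + |q| ^ (2 * k) :=
          (norm_add_le _ _).trans_eq (by simp only [norm_mul, norm_pow, Real.norm_eq_abs])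
      _ ≤ 2 * |q| ^ k + |q| ^ k := by gcongr
      _ = 3 * |q| ^ k := by ring
  have h := (((summable_geometric_of_lt_one (abs_nonneg q) hq).mul_left
    3).hasProdUniformlyOn_nat_one_add isCompact_Icc (.of_forall hbound)
      (fun k => by fun_prop)).tendstoUniformlyOn_finsetRange
  refine (h.congr_right fun y _ => ?_).congr (.of_forall fun N y _ => ?_)
  · simp only [weightProd, add_assoc]
  · simp [weightPoly, eval_prod, add_assoc]

lemma continuousOn_weightProd (hq : |q| < 1) : ContinuousOn (weightProd q) (Set.Icc (-1) 1) :=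
  (tendstoUniformlyOn_weightPoly hq).continuousOn
    (.of_forall fun N => (weightPoly q N).continuous.continuousOn)

lemma integrable_weightProd_mul_eval (hq : |q| < 1) (p : ℝ[X]) :
    Integrable (fun x => weightProd q x * p.eval x) measureT :=
  integrable_measureT ((continuousOn_weightProd hq).mul p.continuous.continuousOn)

lemma tendsto_integral_weightPoly_mul (hq : |q| < 1) (p : ℝ[X]) :
    Tendsto (fun N => ∫ x, (weightPoly q N).eval x * p.eval x ∂measureT) atTop
      (𝓝 (∫ x, weightProd q x * p.eval x ∂measureT)) := by
  refine tendsto_integral_measureT (.of_forall fun N => by fun_prop) ?_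
  have hp : TendstoUniformlyOn (fun (_ : ℕ) x => p.eval x) (fun x => p.eval x) atTop
      (Set.Icc (-1) 1) := fun u hu => .of_forall fun _ _ _ => refl_mem_uniformity hu
  rw [← tendstoLocallyUniformlyOn_iff_tendstoUniformlyOn_of_compact isCompact_Icc]
  exact (tendstoUniformlyOn_weightPoly hq).tendstoLocallyUniformlyOn.mul₀
    hp.tendstoLocallyUniformlyOn (continuousOn_weightProd hq) p.continuous.continuousOn

lemma integral_weightProd_mul_T (hq : |q| < 1) (j : ℤ) :
    ∫ x, weightProd q x * (T ℝ (2 * j)).eval x ∂measureT =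
      Real.pi / qPochInfty q * ((-1) ^ j * (q ^ tri j + q ^ tri (-j))) := by
  have hθ := tendsto_coeff_thetaPoly hq
  have hlim := ((((hθ j).sub (hθ (j + 1))).add ((hθ (-j)).sub (hθ (-j + 1)))).const_mul
    (Real.pi / 2)).congr' <| (eventually_ge_atTop j.natAbs).mono fun N hN =>
      (integral_weightPoly_mul_T (Int.abs_eq_natAbs j ▸ mod_cast hN)).symm
  rw [tendsto_nhds_unique
    ((tendsto_integral_weightPoly_mul hq (T ℝ (2 * j))).comp (tendsto_add_atTop_nat 1)) hlim,
    ← tri_one_sub (j + 1), ← tri_one_sub (-j + 1), show 1 - (j + 1) = -j by ring,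
    show 1 - (-j + 1) = j by ring, zpow_add_one₀ (by norm_num), zpow_add_one₀ (by norm_num),
    zpow_neg, ← inv_zpow, inv_neg_one]
  ring

lemma integral_weightProd_mul_contHermite_even (hq : |q| < 1) (r : ℕ) :
    ∫ x, weightProd q x * (contHermite q (2 * r)).eval x ∂measureT =
      if r = 0 then 2 * Real.pi / qPochInfty q else 0 := by
  have hterm (k : ℕ) : ∫ x, weightProd q x *
        (gaussBinom q (2 * r) k • T ℝ ((2 * r : ℕ) - 2 * k)).eval x ∂measureT =
      Real.pi / qPochInfty q *
        (gaussBinom q (2 * r) k * ((-1) ^ (k + r) * (q ^ tri (r - k) + q ^ tri (k - r)))) := by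
    have hsign : (-1 : ℝ) ^ (r - k : ℤ) = (-1) ^ (k + r) := by
      rw [zpow_sub₀ (by norm_num), zpow_natCast, zpow_natCast, div_eq_mul_inv, ← inv_pow,
        inv_neg_one, pow_add, mul_comm]
    simp only [eval_smul, smul_eq_mul, mul_left_comm (weightProd q _), integral_const_mul]
    rw [show ((2 * r : ℕ) - 2 * k : ℤ) = 2 * (r - k) by push_cast; ring,
      integral_weightProd_mul_T hq, hsign, neg_sub, mul_left_comm]
  simp only [contHermite_eq_sum_T, eval_finsetSum, mul_sum]
  rw [integral_finsetSum _ fun k _ => integrable_weightProd_mul_eval hq _]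
  simp only [hterm]
  rw [← mul_sum, sum_gaussBinom_mul_tri_add_tri]
  split_ifs <;> ring

end WeightProduct

section ChangeOfVariables

lemma sqrt_one_sub_sq_inv_eq_zero {x : ℝ} (hx : x ∉ Set.Ioo (-1) 1) : √(1 - x ^ 2)⁻¹ = 0 := by
  have hx' : 1 ≤ |x| := not_lt.1 fun h => hx (abs_lt.1 h)
  exact Real.sqrt_eq_zero_of_nonpos
    (inv_nonpos.2 (sub_nonpos.2 ((one_le_sq_iff_one_le_abs x).2 hx')))

lemma integral_mul_sqrt_one_sub_sq_inv (f : ℝ → ℝ) :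
    ∫ x, f x * √(1 - x ^ 2)⁻¹ = ∫ x, f x ∂measureT := by
  rw [integral_measureT, intervalIntegral.integral_of_le (by norm_num)]
  refine (setIntegral_eq_integral_of_forall_compl_eq_zero fun x hx => ?_).symm
  rw [sqrt_one_sub_sq_inv_eq_zero fun h => hx (Set.Ioo_subset_Ioc_self h), mul_zero]

lemma integrable_mul_sqrt_one_sub_sq_inv {f : ℝ → ℝ} (hf : ContinuousOn f (Set.Icc (-1) 1)) :
    Integrable fun x => f x * √(1 - x ^ 2)⁻¹ := by
  rw [← Set.uIcc_of_le (by norm_num)] at hf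
  have h := intervalIntegrable_sqrt_one_sub_sq_inv.continuousOn_mul hf
  rw [intervalIntegrable_iff_integrableOn_Ioc_of_le (by norm_num)] at h
  refine (integrableOn_iff_integrable_of_support_subset fun x hx => ?_).1 h
  by_contra hx'
  have h0 := sqrt_one_sub_sq_inv_eq_zero fun h => hx' (Set.Ioo_subset_Ioc_self h)
  exact hx (mul_eq_zero_of_right _ h0)

variable {q : ℝ}

lemma weight_two_div_sqrt_mul (hq : q < 1) (y : ℝ) :
    weight q (2 / √(1 - q) * y) =
      √(1 - q) * qPochInfty q / (4 * Real.pi) * (weightProd q y * √(1 - y ^ 2)⁻¹) := by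
  have : 0 < √(1 - q) := Real.sqrt_pos.2 (sub_pos.2 hq)
  have hsq : (2 / √(1 - q) * y) ^ 2 * (1 - q) = 4 * y ^ 2 := by
    rw [mul_pow, div_pow, Real.sq_sqrt (sub_pos.2 hq).le]
    field_simp [(sub_pos.2 hq).ne']
    ring
  have hmem : |2 / √(1 - q) * y| < 2 / √(1 - q) ↔ |y| < 1 := by
    rw [abs_mul, abs_of_pos (by positivity), mul_lt_iff_lt_one_right (by positivity)]
  rw [weight, weightProd, hsq, mul_comm (1 - q), hsq, mul_div_cancel_left₀ _ (by norm_num),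
    if_congr hmem rfl rfl]
  split_ifs with hy
  · rw [Real.sqrt_inv]
    ring
  · rw [sqrt_one_sub_sq_inv_eq_zero fun h => hy (abs_lt.2 h), mul_zero, mul_zero]

lemma integral_weight_mul (hq : q < 1) (f : ℝ → ℝ) :
    ∫ x, weight q x * f x =
      qPochInfty q / (2 * Real.pi) *
        ∫ y, weightProd q y * f (2 / √(1 - q) * y) ∂measureT := by
  have : 0 < √(1 - q) := Real.sqrt_pos.2 (sub_pos.2 hq)
  calc ∫ x, weight q x * f x
      = 2 / √(1 - q) * ∫ y, weight q (2 / √(1 - q) * y) * f (2 / √(1 - q) * y) := by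
        rw [Measure.integral_comp_mul_left (fun x => weight q x * f x), smul_eq_mul,
          abs_of_pos (by positivity), mul_inv_cancel_left₀ (by positivity)]
    _ = 2 / √(1 - q) * ∫ y, √(1 - q) * qPochInfty q / (4 * Real.pi) *
          (weightProd q y * f (2 / √(1 - q) * y) * √(1 - y ^ 2)⁻¹) := by
        simp only [weight_two_div_sqrt_mul hq, mul_assoc, mul_comm (√_⁻¹)]
    _ = qPochInfty q / (2 * Real.pi) *
          ∫ y, weightProd q y * f (2 / √(1 - q) * y) ∂measureT := by
        rw [integral_const_mul, integral_mul_sqrt_one_sub_sq_inv]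
        field_simp
        ring

lemma integrable_weight_mul (hq : |q| < 1) {f : ℝ → ℝ} (hf : Continuous f) :
    Integrable fun x => weight q x * f x := by
  have hq' := (abs_lt.1 hq).2
  have : 0 < √(1 - q) := Real.sqrt_pos.2 (sub_pos.2 hq')
  rw [← integrable_comp_mul_left_iff _ (show 2 / √(1 - q) ≠ 0 by positivity)]
  have hcont : ContinuousOn (fun y => weightProd q y * f (2 / √(1 - q) * y)) (Set.Icc (-1) 1) :=
    (continuousOn_weightProd hq).mul (by fun_prop)
  refine ((integrable_mul_sqrt_one_sub_sq_inv hcont).const_mul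
    (√(1 - q) * qPochInfty q / (4 * Real.pi))).congr (.of_forall fun y => ?_)
  simp only [weight_two_div_sqrt_mul hq']
  ring

lemma rescaledHermite_two_div_sqrt_mul (hq : q < 1) (n : ℕ) (y : ℝ) :
    rescaledHermite q n (2 / √(1 - q) * y) = (contHermite q n).eval y / √(1 - q) ^ n := by
  have : 0 < √(1 - q) := Real.sqrt_pos.2 (sub_pos.2 hq)
  rw [rescaledHermite]
  congr 2
  field_simp

lemma eval_neg_contHermite (q : ℝ) (n : ℕ) (x : ℝ) :
    (contHermite q n).eval (-x) = (-1) ^ n * (contHermite q n).eval x := by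
  induction n using Nat.twoStepInduction with
  | zero => simp only [contHermite, eval_one, pow_zero, mul_one]
  | one => simp [contHermite]
  | more n ih₁ ih₂ =>
    simp only [contHermite, eval_sub, eval_mul, eval_C, eval_X, eval_ofNat, ih₁, ih₂]
    ring

lemma weight_neg (q x : ℝ) : weight q (-x) = weight q x := by
  simp only [weight, abs_neg, neg_sq]

lemma rescaledHermite_neg (q : ℝ) (n : ℕ) (x : ℝ) :
    rescaledHermite q n (-x) = (-1) ^ n * rescaledHermite q n x := by
  rw [rescaledHermite, mul_neg, eval_neg_contHermite, rescaledHermite, mul_div_assoc]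

lemma integrable_weight_mul_rescaledHermite (hq : |q| < 1) (n : ℕ) :
    Integrable fun x => weight q x * rescaledHermite q n x := by
  refine integrable_weight_mul hq ?_
  unfold rescaledHermite
  fun_prop

lemma integral_weight_mul_rescaledHermite_of_odd {n : ℕ} (hn : Odd n) :
    ∫ x, weight q x * rescaledHermite q n x = 0 := by
  have h := integral_neg_eq_self (fun x => weight q x * rescaledHermite q n x) volume
  simp only [weight_neg, rescaledHermite_neg, hn.neg_one_pow, neg_one_mul, mul_neg,
    integral_neg] at h
  exact neg_eq_self.1 h

lemma integral_weight_mul_rescaledHermite (hq : |q| < 1) (n : ℕ) :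
    ∫ x, weight q x * rescaledHermite q n x = if n = 0 then 1 else 0 := by
  rcases Nat.even_or_odd' n with ⟨r, rfl | rfl⟩
  · have hq' := (abs_lt.1 hq).2
    have hP := qPochInfty_ne_zero hq
    simp only [integral_weight_mul hq', rescaledHermite_two_div_sqrt_mul hq', ← mul_div_assoc,
      integral_div, integral_weightProd_mul_contHermite_even hq]
    rcases eq_or_ne r 0 with rfl | hr
    · simp only [mul_zero, pow_zero, if_true]
      field_simp
    · rw [if_neg hr, if_neg (by lia), mul_zero, zero_div]
  · rw [integral_weight_mul_rescaledHermite_of_odd (odd_two_mul_add_one r), if_neg (by lia)]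

end ChangeOfVariables

end QHermite

open Finset MeasureTheory QHermite

theorem mainTheorem1 (q : ℝ) (hq₁ : -1 < q) (hq₂ : q < 1) (m : ℕ) (n : Fin m → ℕ) :
    MeasureTheory.Integrable
        (fun x : ℝ => QHermite.weight q x * ∏ j, QHermite.rescaledHermite q (n j) x) ∧
      QHermite.K n q =
        ∫ x : ℝ, QHermite.weight q x * ∏ j, QHermite.rescaledHermite q (n j) x := by
  have hq : |q| < 1 := abs_lt.2 ⟨hq₁, hq₂⟩
  have hint : ∀ A ∈ partialMatchings (Separated (boxStart n)) (∑ j, n j), Integrable fun x =>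
      q ^ openCr (∑ j, n j) A * (weight q x * rescaledHermite q #(openPts (∑ j, n j) A) x) :=
    fun A _ => (integrable_weight_mul_rescaledHermite hq _).const_mul _
  simp only [prod_rescaledHermite hq₂, mul_sum, mul_left_comm (weight q _)]
  refine ⟨integrable_finsetSum _ hint, ?_⟩
  rw [integral_finsetSum _ hint, K_eq_sum_partialMatchings, sum_filter]
  refine sum_congr rfl fun A _ => ?_
  rw [integral_const_mul, integral_weight_mul_rescaledHermite hq]
  simp only [card_eq_zero, mul_ite, mul_one, mul_zero]
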